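/- Let $H$ be a real or complex Hilbert space whose inner product $\langle\cdot,\cdot\rangle$ is, in the complex case, linear in its first argument. Let $A$ be the infinitesimal generator of a $C_0$-semigroup of contractions $(S(t))_{t\ge 0}$ on $H$, and let $B$ be a compact bounded linear operator on $H$ such that, for every $y\in H$, $$\langle BS(t)y,S(t)y\rangle=0\ \text{ for all } t\ge 0\quad\Longrightarrow\quad y=0 .$$ Then the feedback control $v_0(t)=-\langle z(t),Bz(t)\rangle$ weakly stabilizes the bilinear system $\dot z(t)=Az(t)+v(t)Bz(t)$, $z(0)=z_0$. That is, consider the closed-loop system $$\dot z(t)=Az(t)-\langle z(t),Bz(t)\rangle Bz(t),\qquad z(0)=z_0\in H,$$ and call $z\in C([0,\infty);H)$ a (global) mild solution of it if $z(t)=S(t)z_0-\int_0^t\langle z(s),Bz(s)\rangle S(t-s)Bz(s)\,ds$ for all $t\ge 0$. Then: 1. for every $z_0\in H$ there is exactly one global mild solution; 2. the origin is Lyapunov stable: for every $\varepsilon>0$ there is $\alpha>0$ such that $\|z_0\|<\alpha$ implies $\|z(t)\|<\varepsilon$ for all $t\ge 0$; 3. for every $z_0\in H$, $z(t)\rightharpoonup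 0$ weakly in $H$ as $t\to+\infty$. -/

import Mathlib

open Set Filter Topology MeasureTheory

section BilinearStabilization

variable {𝕜 H : Type*} [RCLike 𝕜] [NormedAddCommGroup H] [InnerProductSpace 𝕜 H]

/-- `S` (only its values at times `t ≥ 0` matter) is a strongly continuous one-parameter semigroup
of bounded linear operators on `H`, i.e. a C₀-semigroup. -/
structure IsC0Semigroup (S : ℝ → H →L[𝕜] H) : Prop where
  map_zero : S 0 = ContinuousLinearMap.id 𝕜 H
  map_add : ∀ s t : ℝ, 0 ≤ s → 0 ≤ t → S (s + t) = (S s).comp (S t)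
  continuousOn : ∀ x : H, ContinuousOn (fun t => S t x) (Ici 0)

/-- A C₀-semigroup of contractions. -/
structure IsContractionSemigroup (S : ℝ → H →L[𝕜] H) : Prop extends IsC0Semigroup S where
  norm_le_one : ∀ t : ℝ, 0 ≤ t → ‖S t‖ ≤ 1

/-- The quadratic feedback `v₀ = -⟨y, B y⟩`, where `⟨·, ·⟩` is linear in its first argument; since
Mathlib's `inner 𝕜` is linear in its second argument, `⟨y, B y⟩` is `inner 𝕜 (B y) y`. -/
def quadraticFeedback (B : H →L[𝕜] H) (y : H) : 𝕜 :=
  -inner 𝕜 (B y) y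

variable [NormedSpace ℝ H]

/-- The unbounded operator `A` is the infinitesimal generator of `S`: the pair `(x, y)` lies in the
graph of `A` (that is, `x ∈ D(A)` and `A x = y`) if and only if `(S h x - x) / h → y` as `h ↓ 0`. -/
def IsGenerator (A : H →ₗ.[𝕜] H) (S : ℝ → H →L[𝕜] H) : Prop :=
  ∀ x y : H, (x, y) ∈ A.graph ↔
    Tendsto (fun h : ℝ => h⁻¹ • (S h x - x)) (𝓝[>] 0) (𝓝 y)

/-- `z` (restricted to `[0, ∞)`) is a global mild solution of `z' = A z + F(t, z)`, `z(0) = z₀`,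
where `S` is the semigroup generated by `A`: it is continuous on `[0, ∞)` and satisfies the
variation of constants formula. -/
structure IsMildSolution (S : ℝ → H →L[𝕜] H) (F : ℝ → H → H) (z₀ : H) (z : ℝ → H) : Prop where
  continuousOn : ContinuousOn z (Ici 0)
  eq_integral : ∀ t : ℝ, 0 ≤ t → z t = S t z₀ + ∫ s in (0 : ℝ)..t, S (t - s) (F s (z s))

/-- The system `z' = A z + F(t, z)` is weakly stable at the origin: every initial state gives rise
to a unique (global mild) solution, the origin is Lyapunov stable, and all solutions
converge weakly to `0` as `t → +∞`. -/
structure IsWeaklyStable (S : ℝ → H →L[𝕜] H) (F : ℝ → H → H) : Prop where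
  exists_unique_solution : ∀ z₀ : H, ∃ z : ℝ → H, IsMildSolution S F z₀ z ∧
    ∀ w : ℝ → H, IsMildSolution S F z₀ w → EqOn w z (Ici 0)
  lyapunov_stable : ∀ ε : ℝ, 0 < ε → ∃ α : ℝ, 0 < α ∧
    ∀ (z₀ : H) (z : ℝ → H), IsMildSolution S F z₀ z → ‖z₀‖ < α → ∀ t : ℝ, 0 ≤ t → ‖z t‖ < ε
  tendsto_weakly : ∀ (z₀ : H) (z : ℝ → H), IsMildSolution S F z₀ z →
    Tendsto (fun t : ℝ => toWeakSpace 𝕜 H (z t)) atTop (𝓝 0)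

/-- The feedback control `v(t) = V(z(t))` weakly stabilizes the bilinear system
`z' = A z + v(t) B z`. -/
def IsWeaklyStabilizing (S : ℝ → H →L[𝕜] H) (B : H →L[𝕜] H) (V : H → 𝕜) : Prop :=
  IsWeaklyStable S (fun _ y => V y • B y)

end BilinearStabilization

/-! Write `f y = -⟨y, B y⟩ B y`. Since `Re ⟨y, f y⟩ = -|⟨y, B y⟩|²` and the semigroup is
contractive, `‖z‖²` decreases along solutions at rate at least `2 |⟨z, B z⟩|²`. Mild solutions need
not be differentiable, so this is proved through a one-sided Dini derivative
(`IsMildSolution.norm_sq_le`). It gives `‖z t‖ ≤ ‖z₀‖`, hence Lyapunov stability. It also gives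
well-posedness: `f` may be truncated outside a ball to become globally Lipschitz without affecting
solutions.

For weak convergence, the energy has a limit, so its drop over a window of fixed length tends to
`0`. Compactness of `B` makes `⟨z, B z⟩` uniformly continuous to the right along the trajectory, and
a Barbalat-type argument yields `⟨z t, B (z t)⟩ → 0` (`IsMildSolution.tendsto_quadraticForm`). The
control term then vanishes asymptotically, so `z (t + s)` approaches the free evolution `S s (z t)`.

If `z t` converges weakly to `y` along an ultrafilter, compactness of `B` permits passing to the
limit in the quadratic form: `⟨S s y, B (S s y)⟩ = 0` for all `s ≥ 0`. The observability hypothesis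
forces `y = 0`. As the trajectory is bounded, every ultrafilter finer than `atTop` has a weak limit,
so the whole trajectory tends weakly to `0`. -/

/-! ### Weak limits along ultrafilters and compact operators -/

section WeakLimits

variable {𝕜 H : Type*} [RCLike 𝕜] [NormedAddCommGroup H] [InnerProductSpace 𝕜 H]

/-- Bounded families in a Hilbert space converge weakly along every ultrafilter. -/
theorem exists_tendsto_inner_of_ultrafilter [CompleteSpace H] {ι : Type*} (U : Ultrafilter ι)
    {u : ι → H} {R : ℝ} (hu : ∀ᶠ i in (U : Filter ι), ‖u i‖ ≤ R) :
    ∃ y : H, ∀ x : H, Tendsto (fun i => inner 𝕜 (u i) x) U (𝓝 (inner 𝕜 y x)) := by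
  have hK := WeakDual.isCompact_closedBall (𝕜 := 𝕜) (E := H) 0 R
  let w : ι → WeakDual 𝕜 H := fun i =>
    StrongDual.toWeakDual (InnerProductSpace.toDual 𝕜 H (u i))
  have hw : (U.map w : Filter (WeakDual 𝕜 H)) ≤
      𝓟 (WeakDual.toStrongDual ⁻¹' Metric.closedBall (0 : StrongDual 𝕜 H) R) := by
    rw [le_principal_iff, Ultrafilter.coe_map, mem_map]
    filter_upwards [hu] with i hi
    have : InnerProductSpace.toDual 𝕜 H (u i) ∈ Metric.closedBall (0 : StrongDual 𝕜 H) R := by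
      simpa using hi
    exact this
  obtain ⟨l, -, hl⟩ := hK.ultrafilter_le_nhds _ hw
  refine ⟨(InnerProductSpace.toDual 𝕜 H).symm (WeakDual.toStrongDual l), fun x => ?_⟩
  have h1 : Tendsto w U (𝓝 l) := hl
  have h2 := ((WeakDual.eval_continuous x).tendsto l).comp h1
  rw [InnerProductSpace.toDual_symm_apply]
  exact h2

/-- A compact operator maps bounded weakly convergent families to strongly convergent ones (along an
ultrafilter). -/
theorem IsCompactOperator.tendsto_of_tendsto_inner [CompleteSpace H] {B : H →L[𝕜] H}
    (hB : IsCompactOperator B) {ι : Type*} (U : Ultrafilter ι) {u : ι → H} {R : ℝ}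
    (hu : ∀ᶠ i in (U : Filter ι), ‖u i‖ ≤ R) {y : H}
    (hy : ∀ x : H, Tendsto (fun i => inner 𝕜 (u i) x) U (𝓝 (inner 𝕜 y x))) :
    Tendsto (fun i => B (u i)) U (𝓝 (B y)) := by
  obtain ⟨K, hK, hBK⟩ := IsCompactOperator.image_closedBall_subset_compact (f := B.toLinearMap) hB R
  have hw : (U.map (fun i => B (u i)) : Filter H) ≤ 𝓟 K := by
    rw [le_principal_iff, Ultrafilter.coe_map, mem_map]
    filter_upwards [hu] with i hi
    exact hBK ⟨u i, by simpa using hi, rfl⟩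
  obtain ⟨k, -, hk⟩ := hK.ultrafilter_le_nhds _ hw
  have hk' : Tendsto (fun i => B (u i)) U (𝓝 k) := hk
  have : k = B y := by
    refine ext_inner_right 𝕜 fun x => ?_
    refine tendsto_nhds_unique (hk'.inner tendsto_const_nhds) ?_
    have := hy (ContinuousLinearMap.adjoint B x)
    simpa only [ContinuousLinearMap.adjoint_inner_right] using this
  exact this ▸ hk'

/-- A weakly convergent bounded factor paired with a strongly convergent one: compactness supplies
the strong convergence of `B (u i)`. -/
theorem IsCompactOperator.tendsto_inner_self [CompleteSpace H] {B : H →L[𝕜] H}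
    (hB : IsCompactOperator B) {ι : Type*} (U : Ultrafilter ι) {u : ι → H} {R : ℝ}
    (hu : ∀ᶠ i in (U : Filter ι), ‖u i‖ ≤ R) {y : H}
    (hy : ∀ x : H, Tendsto (fun i => inner 𝕜 (u i) x) U (𝓝 (inner 𝕜 y x))) :
    Tendsto (fun i => inner 𝕜 (u i) (B (u i))) U (𝓝 (inner 𝕜 y (B y))) := by
  have hs := hB.tendsto_of_tendsto_inner U hu hy
  have h0 : Tendsto (fun i => inner 𝕜 (u i) (B (u i) - B y)) U (𝓝 0) := by
    have h1 : Tendsto (fun i => R * ‖B (u i) - B y‖) U (𝓝 0) := by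
      simpa using (tendsto_iff_norm_sub_tendsto_zero.1 hs).const_mul R
    refine squeeze_zero_norm' ?_ h1
    filter_upwards [hu] with i hi
    exact (norm_inner_le_norm _ _).trans (by gcongr)
  have := h0.add (hy (B y))
  simpa [inner_sub_right] using this

theorem tendsto_toWeakSpace_zero_of_inner [CompleteSpace H] {ι : Type*} {l : Filter ι} {u : ι → H}
    (hu : ∀ x : H, Tendsto (fun i => inner 𝕜 (u i) x) l (𝓝 0)) :
    Tendsto (fun i => toWeakSpace 𝕜 H (u i)) l (𝓝 0) := by
  refine (WeakBilin.tendsto_iff_forall_eval_tendsto (topDualPairing 𝕜 H).flip ?_).2 fun φ => ?_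
  · intro x y hxy
    refine ext_inner_left 𝕜 fun v => ?_
    exact LinearMap.congr_fun hxy (InnerProductSpace.toDual 𝕜 H v)
  · have h := (RCLike.continuous_conj.tendsto (0 : 𝕜)).comp
      (hu ((InnerProductSpace.toDual 𝕜 H).symm φ))
    simp only [Function.comp_def, inner_conj_symm, InnerProductSpace.toDual_symm_apply] at h
    rw [map_zero] at h
    have h₀ : (topDualPairing 𝕜 H).flip (0 : H) φ = 0 := map_zero φ
    exact h₀.symm ▸ h

end WeakLimits

/-! ### Contraction semigroups and their adjoints -/

section SemigroupBasics

variable {𝕜 H : Type*} [RCLike 𝕜] [NormedAddCommGroup H] [InnerProductSpace 𝕜 H]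

/-- Every normed real vector space structure on a normed `𝕜`-space is the restriction of scalars. -/
theorem real_smul_eq_coe_smul_of_normedSpace [NormedSpace ℝ H] (r : ℝ) (x : H) :
    r • x = (r : 𝕜) • x := by
  simp

variable {S : ℝ → H →L[𝕜] H}

theorem IsContractionSemigroup.norm_apply_le (hS : IsContractionSemigroup S) {t : ℝ} (ht : 0 ≤ t)
    (x : H) : ‖S t x‖ ≤ ‖x‖ := by
  simpa using (S t).le_of_opNorm_le (hS.norm_le_one t ht) x

/-- Strong continuity in time together with a Lipschitz constant in space uniform in time gives
joint continuity. The truncation `max p.1 0` is needed because `S` is arbitrary at negative times.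
-/
theorem IsContractionSemigroup.continuous_uncurry (hS : IsContractionSemigroup S) :
    Continuous fun p : ℝ × H => S (max p.1 0) p.2 := by
  refine continuous_prod_of_continuous_lipschitzWith' _ 1 (fun t => ?_) fun x => ?_
  · refine LipschitzWith.of_dist_le_mul fun x y => ?_
    simp only [dist_eq_norm, ← map_sub]
    simpa using hS.norm_apply_le (le_max_right t 0) (x - y)
  · exact (hS.continuousOn x).comp_continuous (by fun_prop) fun t => mem_Ici.2 (le_max_right t 0)

/-- The adjoint semigroup is strongly continuous at `0`. -/
theorem IsContractionSemigroup.tendsto_adjoint [CompleteSpace H] (hS : IsContractionSemigroup S)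
    (x : H) : Tendsto (fun h => ContinuousLinearMap.adjoint (S h) x) (𝓝[≥] 0) (𝓝 x) := by
  rw [tendsto_iff_norm_sub_tendsto_zero]
  have h1 : Tendsto (fun h => RCLike.re (inner 𝕜 (S h x) x)) (𝓝[≥] 0) (𝓝 (‖x‖ ^ 2)) := by
    have := (hS.continuousOn x 0 self_mem_Ici).tendsto
    rw [hS.map_zero] at this
    have := (RCLike.continuous_re.tendsto _).comp (this.inner (𝕜 := 𝕜) (tendsto_const_nhds (x := x)))
    simpa [Function.comp_def] using this
  -- Expanding the square and using `‖(S h)* x‖ ≤ ‖x‖` bounds `‖(S h)* x - x‖²` by `2‖x‖² - 2 Re ⟨S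
  -- h x, x⟩`.
  have h2 : Tendsto (fun h => √(2 * ‖x‖ ^ 2 - 2 * RCLike.re (inner 𝕜 (S h x) x))) (𝓝[≥] 0)
      (𝓝 0) := by
    have := (Real.continuous_sqrt.tendsto _).comp ((h1.const_mul 2).const_sub (2 * ‖x‖ ^ 2))
    simpa [Function.comp_def] using this
  refine squeeze_zero' (Eventually.of_forall fun _ => norm_nonneg _) ?_ h2
  filter_upwards [self_mem_nhdsWithin] with h hh
  apply Real.le_sqrt_of_sq_le
  have hle : ‖ContinuousLinearMap.adjoint (S h) x‖ ≤ ‖x‖ := by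
    have := (ContinuousLinearMap.adjoint (S h)).le_of_opNorm_le
      (by simpa using hS.norm_le_one h hh) x
    simpa using this
  rw [@norm_sub_sq 𝕜, ContinuousLinearMap.adjoint_inner_left, inner_re_symm]
  have : ‖ContinuousLinearMap.adjoint (S h) x‖ ^ 2 ≤ ‖x‖ ^ 2 := by gcongr
  linarith

/-- Along a compact `B`, the quadratic form `⟨y, B y⟩` changes little, uniformly on bounded sets,
when `y` is moved by the semigroup for a short time. -/
theorem IsContractionSemigroup.tendsto_quadraticForm_sub [CompleteSpace H]
    (hS : IsContractionSemigroup S) {B : H →L[𝕜] H} (hB : IsCompactOperator B) (R : ℝ) :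
    Tendsto (fun p : ℝ × H => inner 𝕜 (S p.1 p.2) (B (S p.1 p.2)) - inner 𝕜 p.2 (B p.2))
      (𝓝[≥] 0 ×ˢ 𝓟 (Metric.closedBall 0 R)) (𝓝 0) := by
  -- Uniformity over the ball becomes convergence along ultrafilters of pairs (time, point), where
  -- the moving point has a weak limit `y`.
  rw [tendsto_iff_ultrafilter]
  intro U hU
  have hfst : Tendsto Prod.fst (U : Filter (ℝ × H)) (𝓝[≥] 0) := tendsto_fst.mono_left hU
  have hsnd : ∀ᶠ p in (U : Filter (ℝ × H)), ‖p.2‖ ≤ R := by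
    have := (tendsto_snd.mono_left hU).eventually (mem_principal_self _)
    filter_upwards [this] with p hp
    simpa using hp
  have hnonneg : ∀ᶠ p in (U : Filter (ℝ × H)), 0 ≤ p.1 := hfst.eventually self_mem_nhdsWithin
  obtain ⟨y, hy⟩ := exists_tendsto_inner_of_ultrafilter (𝕜 := 𝕜) U hsnd
  -- The moved point has the same weak limit: the semigroup is shifted onto the fixed vector `x`,
  -- where the adjoint converges strongly.
  have hy' : ∀ x : H, Tendsto (fun p : ℝ × H => inner 𝕜 (S p.1 p.2) x) U (𝓝 (inner 𝕜 y x)) := by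
    intro x
    have h0 : Tendsto (fun p : ℝ × H =>
        inner 𝕜 p.2 (ContinuousLinearMap.adjoint (S p.1) x - x)) U (𝓝 0) := by
      have h1 : Tendsto (fun p : ℝ × H => R * ‖ContinuousLinearMap.adjoint (S p.1) x - x‖) U
          (𝓝 0) := by
        simpa using ((tendsto_iff_norm_sub_tendsto_zero.1 (hS.tendsto_adjoint x)).comp
          hfst).const_mul R
      refine squeeze_zero_norm' ?_ h1
      filter_upwards [hsnd] with p hp
      exact (norm_inner_le_norm _ _).trans (by gcongr)
    simpa [inner_sub_right, ContinuousLinearMap.adjoint_inner_right] using h0.add (hy x)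
  have hsnd' : ∀ᶠ p in (U : Filter (ℝ × H)), ‖S p.1 p.2‖ ≤ R := by
    filter_upwards [hsnd, hnonneg] with p hp hp'
    exact (hS.norm_apply_le hp' _).trans hp
  simpa using (hB.tendsto_inner_self U hsnd' hy').sub (hB.tendsto_inner_self U hsnd hy)

end SemigroupBasics

/-! ### Mild solutions and the energy inequality -/

section MildSolutions

variable {𝕜 H : Type*} [RCLike 𝕜] [NormedAddCommGroup H] [InnerProductSpace 𝕜 H]
variable {S : ℝ → H →L[𝕜] H}

theorem IsContractionSemigroup.continuousOn_convolution_integrand (hS : IsContractionSemigroup S)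
    {g : ℝ → H} (hg : ContinuousOn g (Ici 0)) (t : ℝ) :
    ContinuousOn (fun r => S (t - r) (g r)) (Icc 0 t) := by
  have h : ContinuousOn (fun r => S (max (t - r) 0) (g r)) (Icc 0 t) :=
    hS.continuous_uncurry.comp_continuousOn
      (ContinuousOn.prodMk (by fun_prop) (hg.mono Icc_subset_Ici_self))
  refine h.congr fun r hr => ?_
  simp only [max_eq_left (sub_nonneg.2 hr.2)]

variable [NormedSpace ℝ H] {f : H → H} {z₀ : H} {z : ℝ → H}

theorem IsMildSolution.apply_zero (hS : IsContractionSemigroup S) {F : ℝ → H → H}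
    (hz : IsMildSolution S F z₀ z) : z 0 = z₀ := by
  simpa [hS.map_zero] using hz.eq_integral 0 le_rfl

/-- Time translates of mild solutions of autonomous equations are mild solutions. -/
theorem IsMildSolution.translate [CompleteSpace H] (hS : IsContractionSemigroup S)
    (hf : Continuous f) (hz : IsMildSolution S (fun _ => f) z₀ z) {s : ℝ} (hs : 0 ≤ s) :
    IsMildSolution S (fun _ => f) (z s) (fun t => z (s + t)) where
  continuousOn := hz.continuousOn.comp (by fun_prop) fun t ht => mem_Ici.2 (add_nonneg hs ht)
  eq_integral t ht := by
    have hg : ContinuousOn (fun r => f (z r)) (Ici 0) := hf.comp_continuousOn hz.continuousOn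
    have hc := hS.continuousOn_convolution_integrand hg (s + t)
    have hi₁ : IntervalIntegrable (fun r => S (s + t - r) (f (z r))) volume 0 s :=
      (hc.mono (by rw [uIcc_of_le hs]; exact Icc_subset_Icc_right (by linarith))).intervalIntegrable
    have hi₂ : IntervalIntegrable (fun r => S (s + t - r) (f (z r))) volume s (s + t) :=
      (hc.mono (by
        rw [uIcc_of_le (by linarith)]; exact Icc_subset_Icc_left hs)).intervalIntegrable
    have hi₃ : IntervalIntegrable (fun r => S (s - r) (f (z r))) volume 0 s :=
      ((hS.continuousOn_convolution_integrand hg s).mono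
        (by rw [uIcc_of_le hs])).intervalIntegrable
    have h₁ : ∫ r in (0 : ℝ)..s, S (s + t - r) (f (z r)) =
        S t (∫ r in (0 : ℝ)..s, S (s - r) (f (z r))) := by
      rw [← ContinuousLinearMap.intervalIntegral_comp_comm _ hi₃]
      refine intervalIntegral.integral_congr fun r hr => ?_
      rw [uIcc_of_le hs] at hr
      have := hS.map_add t (s - r) ht (sub_nonneg.2 hr.2)
      simp only [show s + t - r = t + (s - r) by ring, this, ContinuousLinearMap.comp_apply]
    have h₂ : ∫ r in s..(s + t), S (s + t - r) (f (z r)) =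
        ∫ r in (0 : ℝ)..t, S (t - r) (f (z (s + r))) := by
      have := intervalIntegral.integral_comp_add_left
        (a := 0) (b := t) (fun r => S (s + t - r) (f (z r))) s
      simp only [add_zero, add_sub_add_left_eq_sub] at this
      exact this.symm
    have h₃ : S (s + t) z₀ = S t (S s z₀) := by
      rw [add_comm, hS.map_add t s ht hs, ContinuousLinearMap.comp_apply]
    rw [hz.eq_integral (s + t) (add_nonneg hs ht), hz.eq_integral s hs,
      ← intervalIntegral.integral_add_adjacent_intervals hi₁ hi₂, h₁, h₂, h₃, map_add, add_assoc]

/-- Near time `0` a mild solution is, to first order, the free evolution plus `t • f z₀`. -/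
theorem IsMildSolution.tendsto_inv_smul_integral [CompleteSpace H] (hS : IsContractionSemigroup S)
    (hf : Continuous f) (hz : IsMildSolution S (fun _ => f) z₀ z) :
    Tendsto (fun h : ℝ => h⁻¹ • ∫ r in (0 : ℝ)..h, S (h - r) (f (z r))) (𝓝[>] 0) (𝓝 (f z₀)) := by
  have hg : ContinuousOn (fun r => f (z r)) (Ici 0) := hf.comp_continuousOn hz.continuousOn
  have hg' : Continuous fun t : ℝ => f (z (max t 0)) :=
    hg.comp_continuous (by fun_prop) fun t => mem_Ici.2 (le_max_right t 0)
  -- The truncations extend the integrand continuously to the whole plane, so that it is close to `f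
  -- z₀` near the origin.
  have hk : Continuous fun p : ℝ × ℝ => S (max (p.1 - p.2) 0) (f (z (max p.2 0))) :=
    hS.continuous_uncurry.comp 
      (Continuous.prodMk (f := fun p : ℝ × ℝ => p.1 - p.2) (by fun_prop)
        (hg'.comp continuous_snd))
  have hk0 := hk.tendsto (0, 0)
  simp only [sub_zero, max_self, hS.map_zero, hz.apply_zero hS,
    ContinuousLinearMap.id_apply] at hk0
  rw [Metric.tendsto_nhds]
  intro ε hε
  obtain ⟨δ, hδ, hkδ⟩ := Metric.tendsto_nhds_nhds.1 hk0 (ε / 2) (half_pos hε)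
  filter_upwards [Ioo_mem_nhdsGT hδ] with h hh
  have hi : IntervalIntegrable (fun r => S (h - r) (f (z r))) volume 0 h :=
    ((hS.continuousOn_convolution_integrand hg h).mono
      (by rw [uIcc_of_le hh.1.le])).intervalIntegrable
  have h₁ : ‖∫ r in (0 : ℝ)..h, (S (h - r) (f (z r)) - f z₀)‖ ≤ ε / 2 * |h - 0| := by
    refine intervalIntegral.norm_integral_le_of_norm_le_const fun r hr => ?_
    rw [uIoc_of_le hh.1.le] at hr
    have := @hkδ (h, r) (by
      simp only [Prod.dist_eq, Real.dist_0_eq_abs, max_lt_iff, abs_lt]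
      refine ⟨⟨?_, ?_⟩, ?_, ?_⟩ <;> linarith [hh.1, hh.2, hr.1, hr.2])
    simp only [max_eq_left (sub_nonneg.2 hr.2), max_eq_left hr.1.le, dist_eq_norm] at this
    exact this.le
  rw [intervalIntegral.integral_sub hi intervalIntegrable_const, intervalIntegral.integral_const,
    sub_zero, abs_of_pos hh.1] at h₁
  have h₂ : (h⁻¹ • ∫ r in (0 : ℝ)..h, S (h - r) (f (z r))) - f z₀ =
      h⁻¹ • ((∫ r in (0 : ℝ)..h, S (h - r) (f (z r))) - h • f z₀) := by
    rw [smul_sub, inv_smul_smul₀ hh.1.ne']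
  rw [dist_eq_norm, h₂, norm_smul, norm_inv, Real.norm_of_nonneg hh.1.le]
  calc h⁻¹ * _ ≤ h⁻¹ * (ε / 2 * h) := by gcongr; exact inv_nonneg.2 hh.1.le
    _ = ε / 2 := by have := hh.1.ne'; field_simp
    _ < ε := half_lt_self hε

/-- The upper right Dini derivative of `‖z‖ ^ 2` is at most `2 Re ⟨z, f z⟩`, at time `0`. -/
theorem IsMildSolution.eventually_norm_sq_lt [CompleteSpace H] (hS : IsContractionSemigroup S)
    (hf : Continuous f) (hz : IsMildSolution S (fun _ => f) z₀ z) {r : ℝ}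
    (hr : 2 * RCLike.re (inner 𝕜 z₀ (f z₀)) < r) :
    ∀ᶠ h in 𝓝[>] (0 : ℝ), ‖z h‖ ^ 2 < ‖z₀‖ ^ 2 + r * h := by
  set J : ℝ → H := fun h => h⁻¹ • ∫ r in (0 : ℝ)..h, S (h - r) (f (z r)) with hJ
  have hJ0 : Tendsto J (𝓝[>] 0) (𝓝 (f z₀)) := hz.tendsto_inv_smul_integral hS hf
  have hS0 : Tendsto (fun h => S h z₀) (𝓝[>] 0) (𝓝 z₀) := by
    have := (hS.continuousOn z₀ 0 self_mem_Ici).tendsto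
    rw [hS.map_zero] at this
    exact this.mono_left (nhdsWithin_mono _ Ioi_subset_Ici_self)
  have hh0 : Tendsto (fun h : ℝ => h) (𝓝[>] 0) (𝓝 0) := nhdsWithin_le_nhds
  have hlim : Tendsto (fun h => 2 * RCLike.re (inner 𝕜 (S h z₀) (J h)) + h * ‖J h‖ ^ 2) (𝓝[>] 0)
      (𝓝 (2 * RCLike.re (inner 𝕜 z₀ (f z₀)))) := by
    have h₁ := ((RCLike.continuous_re.tendsto _).comp (hS0.inner (𝕜 := 𝕜) hJ0)).const_mul 2
    have h₂ := hh0.mul (hJ0.norm.pow 2)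
    simpa using h₁.add h₂
  filter_upwards [hlim.eventually_lt_const hr, self_mem_nhdsWithin] with h hlt hpos
  have hpos : 0 < h := hpos
  -- Expanding `‖S h z₀ + h J h‖²` leaves `‖S h z₀‖² ≤ ‖z₀‖²` plus `h` times the quantity in `hlim`.
  have hzh : z h = S h z₀ + (h : 𝕜) • J h := by
    rw [← real_smul_eq_coe_smul_of_normedSpace, hJ]
    simp only [smul_inv_smul₀ hpos.ne']
    exact hz.eq_integral h hpos.le
  have hle : ‖S h z₀‖ ^ 2 ≤ ‖z₀‖ ^ 2 := by
    gcongr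
    exact hS.norm_apply_le hpos.le z₀
  rw [hzh, @norm_add_sq 𝕜, inner_smul_right, RCLike.re_ofReal_mul, norm_smul, RCLike.norm_ofReal,
    abs_of_pos hpos]
  nlinarith [mul_lt_mul_of_pos_right hlt hpos]

/-- Energy inequality for mild solutions. -/
theorem IsMildSolution.norm_sq_le [CompleteSpace H] (hS : IsContractionSemigroup S)
    (hf : Continuous f) (hz : IsMildSolution S (fun _ => f) z₀ z) {T c : ℝ} (hT : 0 ≤ T)
    (hc : ∀ t, 0 ≤ t → t < T → RCLike.re (inner 𝕜 (z t) (f (z t))) ≤ -c) :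
    ‖z T‖ ^ 2 ≤ ‖z₀‖ ^ 2 - 2 * c * T := by
  refine image_le_of_liminf_slope_right_le_deriv_boundary (f := fun t => ‖z t‖ ^ 2)
    (B := fun t => ‖z₀‖ ^ 2 - 2 * c * t) (B' := fun _ => - (2 * c)) (a := 0) (b := T)
    ((hz.continuousOn.mono Icc_subset_Ici_self).norm.pow 2) (by simp [hz.apply_zero hS])
    (by fun_prop) (fun t _ => ?_) (fun t ht r hr => ?_) ⟨hT, le_rfl⟩
  · simpa using (((hasDerivAt_id t).const_mul (2 * c)).const_sub (‖z₀‖ ^ 2)).hasDerivWithinAt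
  -- Translation in time carries the estimate at time `0` to time `t`.
  · have h := (hz.translate hS hf ht.1).eventually_norm_sq_lt hS hf (r := r)
      (by linarith [hc t ht.1 ht.2])
    have hsub : Tendsto (fun y => y - t) (𝓝[>] t) (𝓝[>] 0) := by
      refine tendsto_nhdsWithin_iff.2 ⟨?_, ?_⟩
      · exact ((continuous_id.sub continuous_const).tendsto' t 0 (by simp)).mono_left
          nhdsWithin_le_nhds
      · filter_upwards [self_mem_nhdsWithin] with y hy
        exact mem_Ioi.2 (sub_pos.2 (mem_Ioi.1 hy))
    refine Eventually.frequently ?_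
    filter_upwards [hsub.eventually h, self_mem_nhdsWithin] with y hy hty
    have hty : 0 < y - t := sub_pos.2 (mem_Ioi.1 hty)
    rw [slope_def_field, div_lt_iff₀ hty]
    simp only [add_sub_cancel] at hy
    linarith

theorem IsMildSolution.norm_le [CompleteSpace H] (hS : IsContractionSemigroup S)
    (hf : Continuous f) (hz : IsMildSolution S (fun _ => f) z₀ z)
    (hdiss : ∀ y, RCLike.re (inner 𝕜 y (f y)) ≤ 0) {t : ℝ} (ht : 0 ≤ t) : ‖z t‖ ≤ ‖z₀‖ := by
  have := hz.norm_sq_le hS hf ht (c := 0) fun s _ _ => by simpa using hdiss (z s)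
  exact le_of_sq_le_sq (by simpa using this) (norm_nonneg _)

end MildSolutions

/-! ### Global solutions for Lipschitz nonlinearities -/

section LipschitzExistence

open scoped NNReal BoundedContinuousFunction

variable {𝕜 H : Type*} [RCLike 𝕜] [NormedAddCommGroup H] [InnerProductSpace 𝕜 H]
variable {S : ℝ → H →L[𝕜] H} [NormedSpace ℝ H] {f : H → H}

theorem integral_exp_mul_le {lam τ : ℝ} (hlam : 0 < lam) :
    ∫ s in (0 : ℝ)..τ, Real.exp (lam * s) ≤ Real.exp (lam * τ) / lam := by
  rw [intervalIntegral.integral_comp_mul_left (f := Real.exp) hlam.ne', integral_exp]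
  simp only [mul_zero, Real.exp_zero, smul_eq_mul]
  rw [inv_mul_eq_div]
  gcongr
  linarith

/-- The variation of constants map at time `max t 0`, in the weighted variable
`u t = exp (-lam * t) • z t`. -/
noncomputable def weightedDuhamel (S : ℝ → H →L[𝕜] H) (f : H → H) (lam : ℝ) (z₀ : H) (u : ℝ → H)
    (t : ℝ) : H :=
  Real.exp (-(lam * max t 0)) • (S (max t 0) z₀ +
    ∫ s in (0 : ℝ)..max t 0, S (max t 0 - s) (f (Real.exp (lam * s) • u s)))

theorem continuous_weightedDuhamel (hS : IsContractionSemigroup S) (hf : Continuous f) (lam : ℝ)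
    (z₀ : H) {u : ℝ → H} (hu : Continuous u) : Continuous (weightedDuhamel S f lam z₀ u) := by
  have h₁ : Continuous fun t : ℝ => S (max t 0) z₀ :=
    hS.continuous_uncurry.comp (Continuous.prodMk (f := fun t : ℝ => t) (by fun_prop)
      continuous_const)
  have hg : Continuous fun s => f (Real.exp (lam * s) • u s) := hf.comp (by fun_prop)
  have h₂ : Continuous (Function.uncurry fun t s : ℝ =>
      S (max (max t 0 - s) 0) (f (Real.exp (lam * s) • u s))) :=
    hS.continuous_uncurry.comp (Continuous.prodMk (f := fun p : ℝ × ℝ => max p.1 0 - p.2)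
      (by fun_prop) (hg.comp continuous_snd))
  have h₃ : Continuous fun t : ℝ => ∫ s in (0 : ℝ)..max t 0,
      S (max (max t 0 - s) 0) (f (Real.exp (lam * s) • u s)) :=
    intervalIntegral.continuous_parametric_intervalIntegral_of_continuous h₂ (by fun_prop)
  have h₄ : (fun t : ℝ => ∫ s in (0 : ℝ)..max t 0,
      S (max t 0 - s) (f (Real.exp (lam * s) • u s))) = fun t : ℝ => ∫ s in (0 : ℝ)..max t 0,
      S (max (max t 0 - s) 0) (f (Real.exp (lam * s) • u s)) := by
    funext t
    refine intervalIntegral.integral_congr fun s hs => ?_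
    rw [uIcc_of_le (le_max_right t 0)] at hs
    simp only [max_eq_left (sub_nonneg.2 hs.2)]
  unfold weightedDuhamel
  exact Continuous.smul (by fun_prop) (h₁.add (h₄ ▸ h₃))

/-- The weight turns the Lipschitz bound into an integral of `exp (lam * s)`, at most `exp (lam * τ)
/ lam`. The outer weight cancels the exponential, leaving a constant independent of time that is
small for large `lam`. -/
theorem norm_weightedDuhamel_sub_le (hS : IsContractionSemigroup S) {L : ℝ≥0}
    (hf : LipschitzWith L f) {lam : ℝ} (hlam : 0 < lam) (z₀ : H) {u v : ℝ → H} (hu : Continuous u)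
    (hv : Continuous v) {D : ℝ} (hD : ∀ t, ‖u t - v t‖ ≤ D) (t : ℝ) :
    ‖weightedDuhamel S f lam z₀ u t - weightedDuhamel S f lam z₀ v t‖ ≤ L / lam * D := by
  set τ := max t 0 with hτ
  have hτ0 : 0 ≤ τ := le_max_right t 0
  have hi : ∀ w : ℝ → H, Continuous w →
      IntervalIntegrable (fun s => S (τ - s) (f (Real.exp (lam * s) • w s))) volume 0 τ := by
    intro w hw
    refine ((hS.continuousOn_convolution_integrand (g := fun s => f (Real.exp (lam * s) • w s))
      ?_ τ).mono (by rw [uIcc_of_le hτ0])).intervalIntegrable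
    exact (hf.continuous.comp (by fun_prop)).continuousOn
  have hD0 : 0 ≤ D := (norm_nonneg _).trans (hD 0)
  have hint : ‖∫ s in (0 : ℝ)..τ, (S (τ - s) (f (Real.exp (lam * s) • u s)) -
      S (τ - s) (f (Real.exp (lam * s) • v s)))‖ ≤ ∫ s in (0 : ℝ)..τ, L * D * Real.exp (lam * s) := by
    refine intervalIntegral.norm_integral_le_of_norm_le hτ0 (ae_of_all _ fun s hs => ?_)
      (Continuous.intervalIntegrable (by fun_prop) _ _)
    rw [← map_sub]
    refine (hS.norm_apply_le (sub_nonneg.2 hs.2) _).trans ((hf.norm_sub_le _ _).trans ?_)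
    rw [← smul_sub, norm_smul, Real.norm_of_nonneg (Real.exp_pos _).le]
    calc (L : ℝ) * (Real.exp (lam * s) * ‖u s - v s‖) ≤ L * (Real.exp (lam * s) * D) := by
          gcongr; exact hD s
      _ = _ := by ring
  rw [intervalIntegral.integral_const_mul] at hint
  unfold weightedDuhamel
  rw [← smul_sub, add_sub_add_left_eq_sub, ← hτ, ← intervalIntegral.integral_sub (hi u hu) (hi v hv),
    norm_smul, Real.norm_of_nonneg (Real.exp_pos _).le]
  calc Real.exp (-(lam * τ)) * _
      ≤ Real.exp (-(lam * τ)) * (L * D * (Real.exp (lam * τ) / lam)) := by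
        gcongr
        exact hint.trans (mul_le_mul_of_nonneg_left (integral_exp_mul_le hlam) (by positivity))
    _ = L / lam * D * (Real.exp (-(lam * τ)) * Real.exp (lam * τ)) := by ring
    _ = L / lam * D := by rw [← Real.exp_add]; simp

theorem norm_weightedDuhamel_le (hS : IsContractionSemigroup S) {L : ℝ≥0}
    (hf : LipschitzWith L f) (hf0 : f 0 = 0) {lam : ℝ} (hlam : 0 < lam) (z₀ : H) {u : ℝ → H}
    (hu : Continuous u) {D : ℝ} (hD : ∀ t, ‖u t‖ ≤ D) (t : ℝ) :
    ‖weightedDuhamel S f lam z₀ u t‖ ≤ ‖z₀‖ + L / lam * D := by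
  have h₁ := norm_weightedDuhamel_sub_le hS hf hlam z₀ hu continuous_zero (v := 0) (D := D)
    (by simpa using hD) t
  have h₂ : ‖weightedDuhamel S f lam z₀ 0 t‖ ≤ ‖z₀‖ := by
    simp only [weightedDuhamel, Pi.zero_apply, smul_zero, hf0, map_zero,
      intervalIntegral.integral_zero, add_zero, norm_smul, Real.norm_of_nonneg (Real.exp_pos _).le]
    refine (mul_le_of_le_one_left (norm_nonneg _) ?_).trans (hS.norm_apply_le (le_max_right t 0) _)
    exact Real.exp_le_one_iff.2 (neg_nonpos.2 (mul_nonneg hlam.le (le_max_right t 0)))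
  calc _ = ‖(weightedDuhamel S f lam z₀ u t - weightedDuhamel S f lam z₀ 0 t) +
        weightedDuhamel S f lam z₀ 0 t‖ := by rw [sub_add_cancel]
    _ ≤ _ := norm_add_le _ _
    _ ≤ _ := by linarith

/-- Global existence, and uniqueness among bounded functions, of mild solutions for globally
Lipschitz nonlinearities vanishing at `0`. -/
theorem exists_isMildSolution_of_lipschitzWith [CompleteSpace H] (hS : IsContractionSemigroup S)
    {L : ℝ≥0} (hf : LipschitzWith L f) (hf0 : f 0 = 0) (z₀ : H) :
    ∃ z : ℝ → H, IsMildSolution S (fun _ => f) z₀ z ∧ ∀ w : ℝ → H,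
      IsMildSolution S (fun _ => f) z₀ w → (∃ C, ∀ t, 0 ≤ t → ‖w t‖ ≤ C) → EqOn w z (Ici 0) := by
  -- Chosen so that `L / lam ≤ 1 / 2`; the `+ 1` keeps `lam` positive when `L = 0`. One contraction
  -- then works on the whole half-line.
  set lam : ℝ := 2 * L + 1 with hlam_def
  have hL : (0 : ℝ) ≤ L := L.2
  have hlam : 0 < lam := by positivity
  have hq : L / lam ≤ 1 / 2 := by rw [div_le_iff₀ hlam]; linarith
  let Φ : (ℝ →ᵇ H) → (ℝ →ᵇ H) := fun u =>
    BoundedContinuousFunction.ofNormedAddCommGroup (weightedDuhamel S f lam z₀ u)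
      (continuous_weightedDuhamel hS hf.continuous lam z₀ u.continuous) _
      (norm_weightedDuhamel_le hS hf hf0 hlam z₀ u.continuous u.norm_coe_le_norm)
  have hΦ : ContractingWith (1 / 2) Φ := by
    refine ⟨by rw [← NNReal.coe_lt_coe]; norm_num, LipschitzWith.of_dist_le_mul fun u v => ?_⟩
    refine (BoundedContinuousFunction.dist_le (by positivity)).2 fun t => ?_
    have := norm_weightedDuhamel_sub_le hS hf hlam z₀ u.continuous v.continuous
      (fun s => (dist_eq_norm (u s) (v s)).symm.trans_le (BoundedContinuousFunction.dist_coe_le_dist s))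
      t
    rw [dist_eq_norm]
    refine this.trans ?_
    push_cast
    gcongr
  set u := hΦ.fixedPoint Φ with hu
  have hfix : ∀ t, weightedDuhamel S f lam z₀ u t = u t := fun t =>
    congrArg (fun w : ℝ →ᵇ H => w t) hΦ.fixedPoint_isFixedPt
  have hexp : ∀ a : ℝ, Real.exp a * Real.exp (-a) = 1 := fun a => by rw [← Real.exp_add]; simp
  refine ⟨fun t => Real.exp (lam * t) • u t, ⟨?_, fun t ht => ?_⟩, fun w hw hwC t ht => ?_⟩
  · have := u.continuous
    exact Continuous.continuousOn (by fun_prop)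
  · have := hfix t
    simp only [weightedDuhamel, max_eq_left ht] at this
    rw [← this, smul_smul, hexp, one_smul]
  · obtain ⟨C, hC⟩ := hwC
    -- A bounded solution, weighted and extended by its initial value to negative times, is a
    -- bounded continuous fixed point of `Φ`.
    have hv : Continuous fun t : ℝ => Real.exp (-(lam * max t 0)) • w (max t 0) :=
      Continuous.smul (by fun_prop) (hw.continuousOn.comp_continuous (by fun_prop)
        fun t => mem_Ici.2 (le_max_right t 0))
    let v : ℝ →ᵇ H := BoundedContinuousFunction.ofNormedAddCommGroup _ hv C fun t => by
      rw [norm_smul, Real.norm_of_nonneg (Real.exp_pos _).le]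
      refine (mul_le_of_le_one_left (norm_nonneg _) ?_).trans (hC _ (le_max_right t 0))
      exact Real.exp_le_one_iff.2 (neg_nonpos.2 (mul_nonneg hlam.le (le_max_right t 0)))
    have hvfix : Function.IsFixedPt Φ v := by
      ext t
      change weightedDuhamel S f lam z₀ v t = Real.exp (-(lam * max t 0)) • w (max t 0)
      rw [hw.eq_integral _ (le_max_right t 0)]
      unfold weightedDuhamel
      congr 2
      refine intervalIntegral.integral_congr fun s hs => ?_
      rw [uIcc_of_le (le_max_right t 0)] at hs
      change S (max t 0 - s) (f (Real.exp (lam * s) • Real.exp (-(lam * max s 0)) • w (max s 0))) = _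
      rw [max_eq_left hs.1, smul_smul, hexp, one_smul]
    have hvu : v = u := hΦ.fixedPoint_unique hvfix
    have hvt : u t = Real.exp (-(lam * max t 0)) • w (max t 0) := by rw [← hvu]; rfl
    simp only [hvt, max_eq_left (mem_Ici.1 ht), smul_smul, hexp, one_smul]

end LipschitzExistence

/-! ### The closed loop: well-posedness, decay of the feedback, weak limits -/

section QuadraticFeedback

open scoped NNReal

variable {𝕜 H : Type*} [RCLike 𝕜] [NormedAddCommGroup H] [InnerProductSpace 𝕜 H]

theorem norm_quadraticForm_sub_le (B : H →L[𝕜] H) {R : ℝ} {x y : H} (hx : ‖x‖ ≤ R) (hy : ‖y‖ ≤ R) :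
    ‖inner 𝕜 x (B x) - inner 𝕜 y (B y)‖ ≤ 2 * ‖B‖ * R * ‖x - y‖ := by
  have h : inner 𝕜 x (B x) - inner 𝕜 y (B y) =
      inner 𝕜 x (B (x - y)) + inner 𝕜 (x - y) (B y) := by
    rw [map_sub, inner_sub_right, inner_sub_left]
    ring
  rw [h]
  refine (norm_add_le _ _).trans ?_
  have h₁ : ‖inner 𝕜 x (B (x - y))‖ ≤ R * (‖B‖ * ‖x - y‖) :=
    (norm_inner_le_norm _ _).trans (by gcongr; exacts [(norm_nonneg _).trans hx, B.le_opNorm _])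
  have h₂ : ‖inner 𝕜 (x - y) (B y)‖ ≤ ‖x - y‖ * (‖B‖ * R) :=
    (norm_inner_le_norm _ _).trans (by gcongr; exact B.le_opNorm_of_le hy)
  linarith

theorem norm_quadraticFeedback (B : H →L[𝕜] H) (y : H) :
    ‖quadraticFeedback B y‖ = ‖inner 𝕜 y (B y)‖ := by
  rw [quadraticFeedback, norm_neg, norm_inner_symm]

theorem continuous_quadraticFeedback_smul (B : H →L[𝕜] H) :
    Continuous fun y => quadraticFeedback B y • B y := by
  unfold quadraticFeedback
  fun_prop

theorem re_inner_quadraticFeedback_smul (B : H →L[𝕜] H) (y : H) :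
    RCLike.re (inner 𝕜 y (quadraticFeedback B y • B y)) = -‖inner 𝕜 y (B y)‖ ^ 2 := by
  rw [inner_smul_right, quadraticFeedback, ← inner_conj_symm (B y) y, neg_mul, RCLike.conj_mul,
    ← RCLike.ofReal_pow, map_neg, RCLike.ofReal_re]

theorem norm_quadraticFeedback_smul_le (B : H →L[𝕜] H) {R : ℝ} {y : H} (hy : ‖y‖ ≤ R) :
    ‖quadraticFeedback B y • B y‖ ≤ ‖inner 𝕜 y (B y)‖ * (‖B‖ * R) := by
  rw [norm_smul, norm_quadraticFeedback]
  gcongr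
  exact B.le_opNorm_of_le hy

theorem norm_quadraticForm_le (B : H →L[𝕜] H) {R : ℝ} {y : H} (hy : ‖y‖ ≤ R) :
    ‖inner 𝕜 y (B y)‖ ≤ R * (‖B‖ * R) :=
  (norm_inner_le_norm _ _).trans
    (mul_le_mul hy (B.le_opNorm_of_le hy) (norm_nonneg _) ((norm_nonneg _).trans hy))

/-- The nonlinearity is cubic, so telescoping changes one argument at a time; each of the three
contributes `‖B‖² R² ‖x - y‖`. -/
theorem norm_quadraticFeedback_smul_sub_le (B : H →L[𝕜] H) {R : ℝ} {x y : H} (hx : ‖x‖ ≤ R)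
    (hy : ‖y‖ ≤ R) : ‖quadraticFeedback B x • B x - quadraticFeedback B y • B y‖ ≤
      3 * ‖B‖ ^ 2 * R ^ 2 * ‖x - y‖ := by
  have hR : 0 ≤ R := (norm_nonneg _).trans hx
  have h : quadraticFeedback B x • B x - quadraticFeedback B y • B y =
      quadraticFeedback B x • B (x - y) + (quadraticFeedback B x - quadraticFeedback B y) • B y := by
    rw [map_sub, smul_sub, sub_smul]
    abel
  have hq : ‖quadraticFeedback B x - quadraticFeedback B y‖ =
      ‖inner 𝕜 x (B x) - inner 𝕜 y (B y)‖ := by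
    rw [quadraticFeedback, quadraticFeedback, ← inner_conj_symm (B x), ← inner_conj_symm (B y),
      ← norm_neg, ← RCLike.norm_conj]
    congr 1
    simp
    ring
  rw [h]
  refine (norm_add_le _ _).trans ?_
  rw [norm_smul, norm_smul, hq, norm_quadraticFeedback]
  calc _ ≤ R * (‖B‖ * R) * (‖B‖ * ‖x - y‖) + 2 * ‖B‖ * R * ‖x - y‖ * (‖B‖ * R) := by
        gcongr
        exacts [norm_quadraticForm_le B hx, B.le_opNorm _, norm_quadraticForm_sub_le B hx hy,
          B.le_opNorm_of_le hy]
    _ = _ := by ring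

/-- The radial retraction onto the closed ball of radius `R`. -/
noncomputable def radialRetraction (𝕜 : Type*) {H : Type*} [RCLike 𝕜] [NormedAddCommGroup H]
    [InnerProductSpace 𝕜 H] (R : ℝ) (y : H) : H :=
  ((R / max R ‖y‖ : ℝ) : 𝕜) • y

theorem norm_radialRetraction_le {R : ℝ} (hR : 0 < R) (y : H) :
    ‖radialRetraction 𝕜 R y‖ ≤ R := by
  have hm : 0 < max R ‖y‖ := lt_max_of_lt_left hR
  rw [radialRetraction, norm_smul, RCLike.norm_ofReal, abs_of_nonneg (by positivity), div_mul_eq_mul_div,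
    div_le_iff₀ hm]
  exact mul_le_mul_of_nonneg_left (le_max_right _ _) hR.le

theorem radialRetraction_of_norm_le {R : ℝ} (hR : 0 < R) {y : H} (hy : ‖y‖ ≤ R) :
    radialRetraction 𝕜 R y = y := by
  rw [radialRetraction, max_eq_left hy, div_self hR.ne', RCLike.ofReal_one, one_smul]

/-- Any Lipschitz constant suffices for the truncation. The value `2` comes from the triangle
inequality: one part for moving the point, one for changing the scaling factor. -/
theorem norm_radialRetraction_sub_le {R : ℝ} (hR : 0 < R) (x y : H) :
    ‖radialRetraction 𝕜 R x - radialRetraction 𝕜 R y‖ ≤ 2 * ‖x - y‖ := by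
  set a := max R ‖x‖ with ha
  set b := max R ‖y‖ with hb
  have hRa : R ≤ a := le_max_left _ _
  have hRb : R ≤ b := le_max_left _ _
  have hxa : ‖x‖ ≤ a := le_max_right _ _
  have ha0 : 0 < a := hR.trans_le hRa
  have hb0 : 0 < b := hR.trans_le hRb
  have hab : |b - a| ≤ ‖x - y‖ := by
    have h₁ := abs_max_sub_max_le_max R ‖y‖ R ‖x‖
    rw [sub_self, abs_zero, max_eq_right (abs_nonneg (‖y‖ - ‖x‖))] at h₁
    exact h₁.trans ((abs_norm_sub_norm_le y x).trans_eq (norm_sub_rev y x))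
  have h : radialRetraction 𝕜 R x - radialRetraction 𝕜 R y =
      ((R / b : ℝ) : 𝕜) • (x - y) + ((R / a - R / b : ℝ) : 𝕜) • x := by
    simp only [radialRetraction, ← ha, ← hb]
    push_cast
    rw [smul_sub, sub_smul]
    abel
  have h₁ : |R / a - R / b| * ‖x‖ ≤ |b - a| := by
    have : R / a - R / b = R / b * ((b - a) / a) := by field_simp
    rw [this, abs_mul, abs_div (b - a), abs_of_pos ha0, abs_of_pos (div_pos hR hb0)]
    calc R / b * (|b - a| / a) * ‖x‖ ≤ 1 * (|b - a| / a) * a := by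
          gcongr
          exact (div_le_one hb0).2 hRb
      _ = |b - a| := by field_simp
  rw [h]
  refine (norm_add_le _ _).trans ?_
  rw [norm_smul, norm_smul, RCLike.norm_ofReal, RCLike.norm_ofReal, abs_of_pos (div_pos hR hb0)]
  have h₂ : R / b * ‖x - y‖ ≤ ‖x - y‖ :=
    mul_le_of_le_one_left (norm_nonneg _) ((div_le_one hb0).2 hRb)
  linarith

theorem lipschitzWith_feedback_radialRetraction (B : H →L[𝕜] H) {R : ℝ} (hR : 0 < R) :
    LipschitzWith (Real.toNNReal (6 * ‖B‖ ^ 2 * R ^ 2)) fun y : H =>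
      quadraticFeedback B (radialRetraction 𝕜 R y) • B (radialRetraction 𝕜 R y) := by
  refine LipschitzWith.of_dist_le_mul fun x y => ?_
  rw [Real.coe_toNNReal _ (by positivity), dist_eq_norm, dist_eq_norm]
  calc _ ≤ 3 * ‖B‖ ^ 2 * R ^ 2 * ‖radialRetraction 𝕜 R x - radialRetraction 𝕜 R y‖ :=
        norm_quadraticFeedback_smul_sub_le B (norm_radialRetraction_le hR x)
          (norm_radialRetraction_le hR y)
    _ ≤ 3 * ‖B‖ ^ 2 * R ^ 2 * (2 * ‖x - y‖) := by
        gcongr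
        exact norm_radialRetraction_sub_le hR x y
    _ = _ := by ring

/-- The retraction of `y` is a positive multiple of `y`, so the truncated field inherits
dissipativity from the original one. -/
theorem re_inner_feedback_radialRetraction_nonpos (B : H →L[𝕜] H) {R : ℝ} (hR : 0 < R) (y : H) :
    RCLike.re (inner 𝕜 y
      (quadraticFeedback B (radialRetraction 𝕜 R y) • B (radialRetraction 𝕜 R y))) ≤ 0 := by
  set w := radialRetraction 𝕜 R y with hw
  have hc : 0 < R / max R ‖y‖ := div_pos hR (lt_max_of_lt_left hR)
  have h₁ := re_inner_quadraticFeedback_smul B w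
  nth_rewrite 1 [hw] at h₁
  rw [radialRetraction, inner_smul_left, RCLike.conj_ofReal, RCLike.re_ofReal_mul] at h₁
  refine nonpos_of_mul_nonpos_right (a := R / max R ‖y‖) ?_ hc
  rw [h₁]
  exact neg_nonpos.2 (sq_nonneg _)

variable {S : ℝ → H →L[𝕜] H} [NormedSpace ℝ H] {B : H →L[𝕜] H} {z₀ : H} {z : ℝ → H}

theorem IsMildSolution.congr_of_eqOn {f g : H → H} (hz : IsMildSolution S (fun _ => f) z₀ z)
    (hfg : ∀ t, 0 ≤ t → f (z t) = g (z t)) : IsMildSolution S (fun _ => g) z₀ z where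
  continuousOn := hz.continuousOn
  eq_integral t ht := by
    rw [hz.eq_integral t ht]
    congr 1
    refine intervalIntegral.integral_congr fun s hs => ?_
    rw [uIcc_of_le ht] at hs
    simp only [hfg s hs.1]

theorem IsMildSolution.norm_le_of_feedback [CompleteSpace H] (hS : IsContractionSemigroup S)
    (hz : IsMildSolution S (fun _ y => quadraticFeedback B y • B y) z₀ z) {t : ℝ} (ht : 0 ≤ t) :
    ‖z t‖ ≤ ‖z₀‖ :=
  hz.norm_le hS (continuous_quadraticFeedback_smul B)
    (fun y => by rw [re_inner_quadraticFeedback_smul]; exact neg_nonpos.2 (sq_nonneg _)) ht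

/-- Dissipativity keeps solutions of both the truncated and the original equation in the ball of
radius `‖z₀‖`, where the two nonlinearities agree. The same bound removes the boundedness
restriction on uniqueness. -/
theorem exists_unique_isMildSolution_feedback [CompleteSpace H] (hS : IsContractionSemigroup S)
    (B : H →L[𝕜] H) (z₀ : H) :
    ∃ z : ℝ → H, IsMildSolution S (fun _ y => quadraticFeedback B y • B y) z₀ z ∧
      ∀ w : ℝ → H, IsMildSolution S (fun _ y => quadraticFeedback B y • B y) z₀ w →
        EqOn w z (Ici 0) := by
  -- The `+ 1` gives a positive radius even when `z₀ = 0`.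
  have hR : 0 < ‖z₀‖ + 1 := by positivity
  have hlip := lipschitzWith_feedback_radialRetraction B hR
  obtain ⟨z, hz, hzu⟩ := exists_isMildSolution_of_lipschitzWith hS hlip
    (by simp [radialRetraction]) z₀
  have hzR : ∀ t, 0 ≤ t → ‖z t‖ ≤ ‖z₀‖ := fun t ht =>
    hz.norm_le hS hlip.continuous (re_inner_feedback_radialRetraction_nonpos B hR) ht
  refine ⟨z, hz.congr_of_eqOn fun t ht => ?_, fun w hw => hzu w ?_
    ⟨‖z₀‖, fun t ht => hw.norm_le_of_feedback hS ht⟩⟩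
  · simp only [radialRetraction_of_norm_le hR ((hzR t ht).trans (by linarith))]
  · refine IsMildSolution.congr_of_eqOn (f := fun y => quadraticFeedback B y • B y) hw fun t ht => ?_
    simp only [radialRetraction_of_norm_le hR
      ((hw.norm_le_of_feedback hS ht).trans (by linarith))]

/-- Deviation of a mild solution from the free evolution. -/
theorem IsMildSolution.norm_sub_le {f : H → H} (hS : IsContractionSemigroup S)
    (hz : IsMildSolution S (fun _ => f) z₀ z) {M t : ℝ} (ht : 0 ≤ t)
    (hM : ∀ s, 0 ≤ s → ‖f (z s)‖ ≤ M) : ‖z t - S t z₀‖ ≤ M * t := by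
  rw [hz.eq_integral t ht, add_sub_cancel_left]
  have := intervalIntegral.norm_integral_le_of_norm_le_const (a := 0) (b := t) (C := M)
    (f := fun s => S (t - s) (f (z s))) fun s hs => by
      rw [uIoc_of_le ht] at hs
      exact (hS.norm_apply_le (sub_nonneg.2 hs.2) _).trans (hM s hs.1.le)
  rwa [sub_zero, abs_of_nonneg ht] at this

/-- Along solutions of the closed loop, `⟨z, B z⟩` is uniformly continuous to the right. -/
theorem IsMildSolution.exists_forall_norm_quadraticForm_sub_lt [CompleteSpace H]
    (hS : IsContractionSemigroup S) (hB : IsCompactOperator B)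
    (hz : IsMildSolution S (fun _ y => quadraticFeedback B y • B y) z₀ z) {ε : ℝ} (hε : 0 < ε) :
    ∃ δ > 0, ∀ t, 0 ≤ t → ∀ h ∈ Ico 0 δ,
      ‖inner 𝕜 (z (t + h)) (B (z (t + h))) - inner 𝕜 (z t) (B (z t))‖ < ε := by
  -- The increment splits in two: the deviation from the free evolution, at most `M * h` with `M` a
  -- bound for the nonlinearity on the ball, and the free evolution itself, controlled by
  -- compactness of `B`.
  set R := ‖z₀‖
  have hbd : ∀ t, 0 ≤ t → ‖z t‖ ≤ R := fun t ht => hz.norm_le_of_feedback hS ht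
  set M := R * (‖B‖ * R) * (‖B‖ * R)
  have h₁ := (hS.tendsto_quadraticForm_sub hB R).norm.eventually_lt_const
    (u := ε / 2) (by simpa using half_pos hε)
  rw [eventually_prod_principal_iff] at h₁
  have h₂ : ∀ᶠ h in 𝓝[≥] (0 : ℝ), 2 * ‖B‖ * R * (M * h) < ε / 2 := by
    have : Tendsto (fun h : ℝ => 2 * ‖B‖ * R * (M * h)) (𝓝 0) (𝓝 0) :=
      Continuous.tendsto' (by fun_prop) _ _ (by simp)
    exact (this.mono_left nhdsWithin_le_nhds).eventually_lt_const (half_pos hε)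
  obtain ⟨δ, hδ, hδh⟩ := (nhdsGE_basis (0 : ℝ)).eventually_iff.1 (h₁.and h₂)
  refine ⟨δ, hδ, fun t ht h hh => ?_⟩
  have hSz : ‖S h (z t)‖ ≤ R := (hS.norm_apply_le hh.1 _).trans (hbd t ht)
  have h₃ : ‖z (t + h) - S h (z t)‖ ≤ M * h :=
    (hz.translate hS (continuous_quadraticFeedback_smul B) ht).norm_sub_le hS hh.1 fun s hs => by
      have hzs := hbd (t + s) (add_nonneg ht hs)
      refine (norm_quadraticFeedback_smul_le B hzs).trans ?_
      exact mul_le_mul_of_nonneg_right (norm_quadraticForm_le B hzs) (by positivity)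
  have h₄ := norm_quadraticForm_sub_le B (hbd (t + h) (add_nonneg ht hh.1)) hSz
  have h₅ : 2 * ‖B‖ * R * ‖z (t + h) - S h (z t)‖ ≤ 2 * ‖B‖ * R * (M * h) := by gcongr
  have h₆ := (hδh hh).1 (z t) (by simpa using hbd t ht)
  have h₇ := (hδh hh).2
  calc _ = ‖(inner 𝕜 (z (t + h)) (B (z (t + h))) - inner 𝕜 (S h (z t)) (B (S h (z t)))) +
        (inner 𝕜 (S h (z t)) (B (S h (z t))) - inner 𝕜 (z t) (B (z t)))‖ := by
          rw [sub_add_sub_cancel]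
    _ ≤ _ := norm_add_le _ _
    _ < ε := by simp only at h₆; linarith

/-- The feedback dies out along solutions of the closed loop. -/
theorem IsMildSolution.tendsto_quadraticForm [CompleteSpace H] (hS : IsContractionSemigroup S)
    (hB : IsCompactOperator B)
    (hz : IsMildSolution S (fun _ y => quadraticFeedback B y • B y) z₀ z) :
    Tendsto (fun t => inner 𝕜 (z t) (B (z t))) atTop (𝓝 0) := by
  have hf := continuous_quadraticFeedback_smul B
  have hanti : Antitone fun t : ℝ => ‖z (max t 0)‖ ^ 2 := fun s t hst => by
    have hs : 0 ≤ max s 0 := le_max_right s 0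
    have hle : max s 0 ≤ max t 0 := max_le_max_right 0 hst
    have := (hz.translate hS hf hs).norm_le_of_feedback hS (sub_nonneg.2 hle)
    simp only [add_sub_cancel] at this
    simp only
    gcongr
  have hlim := tendsto_atTop_ciInf hanti
    ⟨0, by rintro _ ⟨t, rfl⟩; exact sq_nonneg _⟩
  rw [Metric.tendsto_nhds]
  intro ε hε
  obtain ⟨δ, hδ, hδh⟩ := hz.exists_forall_norm_quadraticForm_sub_lt hS hB (half_pos hε)
  -- The energy lost on `[t, t + δ]` tends to `0`, since the energy converges.
  have hdiff := hlim.sub (hlim.comp (tendsto_atTop_add_const_right atTop δ tendsto_id))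
  rw [sub_self] at hdiff
  have hc : 0 < 2 * (ε / 2) ^ 2 * δ := by positivity
  filter_upwards [hdiff.eventually_lt_const hc, eventually_ge_atTop 0] with t hlt ht
  rw [dist_zero_right]
  by_contra! hge
  -- If the form has modulus at least `ε` at time `t`, it stays at least `ε / 2` on the next window
  -- of length `δ`, costing energy `2 (ε / 2)² δ`, more than is available.
  have hen := (hz.translate hS hf ht).norm_sq_le hS hf hδ.le (c := (ε / 2) ^ 2) fun h h0 hh => by
    rw [re_inner_quadraticFeedback_smul, neg_le_neg_iff]
    have h₁ := hδh t ht h ⟨h0, hh⟩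
    rw [norm_sub_rev] at h₁
    have h₂ := norm_sub_norm_le (inner 𝕜 (z t) (B (z t))) (inner 𝕜 (z (t + h)) (B (z (t + h))))
    gcongr
    linarith
  simp only [Function.comp_apply, id, max_eq_left ht, max_eq_left (add_nonneg ht hδ.le)] at hlt
  linarith

/-- Over a window of fixed length `s`, the deviation is at most `s` times the supremum of the
control term after time `t`, and that term dies out. -/
theorem IsMildSolution.tendsto_sub_apply [CompleteSpace H] (hS : IsContractionSemigroup S)
    (hB : IsCompactOperator B)
    (hz : IsMildSolution S (fun _ y => quadraticFeedback B y • B y) z₀ z) {s : ℝ} (hs : 0 ≤ s) :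
    Tendsto (fun t => ‖z (t + s) - S s (z t)‖) atTop (𝓝 0) := by
  have hf0 : Tendsto (fun t => ‖quadraticFeedback B (z t) • B (z t)‖) atTop (𝓝 0) := by
    have h₁ : Tendsto (fun t => ‖inner 𝕜 (z t) (B (z t))‖ * (‖B‖ * ‖z₀‖)) atTop (𝓝 0) := by
      simpa using (hz.tendsto_quadraticForm hS hB).norm.mul_const (‖B‖ * ‖z₀‖)
    refine squeeze_zero' (Eventually.of_forall fun _ => norm_nonneg _) ?_ h₁
    filter_upwards [eventually_ge_atTop 0] with t ht
    exact norm_quadraticFeedback_smul_le B (hz.norm_le_of_feedback hS ht)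
  rw [Metric.tendsto_nhds]
  intro ε hε
  -- Dividing by `s + 1` rather than `s` covers `s = 0` and makes the final inequality strict.
  have hη : 0 < ε / (s + 1) := by positivity
  obtain ⟨t₀, ht₀⟩ := eventually_atTop.1 (hf0.eventually_lt_const hη)
  filter_upwards [eventually_ge_atTop t₀, eventually_ge_atTop 0] with t ht ht0
  rw [dist_zero_right, norm_norm]
  refine ((hz.translate hS (continuous_quadraticFeedback_smul B) ht0).norm_sub_le hS hs
    (M := ε / (s + 1)) fun r hr => (ht₀ (t + r) (by linarith)).le).trans_lt ?_
  rw [div_mul_eq_mul_div, div_lt_iff₀ (by positivity)]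
  nlinarith

/-- Weak limits of the trajectory along ultrafilters are unobservable. -/
theorem IsMildSolution.inner_eq_zero_of_weak_limit [CompleteSpace H]
    (hS : IsContractionSemigroup S) (hB : IsCompactOperator B)
    (hz : IsMildSolution S (fun _ y => quadraticFeedback B y • B y) z₀ z) {U : Ultrafilter ℝ}
    (hU : (U : Filter ℝ) ≤ atTop) {y : H}
    (hy : ∀ x : H, Tendsto (fun t => inner 𝕜 (z t) x) U (𝓝 (inner 𝕜 y x))) {s : ℝ} (hs : 0 ≤ s) :
    inner 𝕜 (S s y) (B (S s y)) = 0 := by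
  have hpos : ∀ᶠ t in (U : Filter ℝ), 0 ≤ t := hU (eventually_ge_atTop 0)
  have hbd : ∀ᶠ t in (U : Filter ℝ), ‖S s (z t)‖ ≤ ‖z₀‖ := by
    filter_upwards [hpos] with t ht
    exact (hS.norm_apply_le hs _).trans (hz.norm_le_of_feedback hS ht)
  have hySz : ∀ x : H, Tendsto (fun t => inner 𝕜 (S s (z t)) x) U (𝓝 (inner 𝕜 (S s y) x)) :=
    fun x => by
      simpa only [ContinuousLinearMap.adjoint_inner_right] using
        hy (ContinuousLinearMap.adjoint (S s) x)
  have h₁ := hB.tendsto_inner_self U hbd hySz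
  have h₂ : Tendsto (fun t => inner 𝕜 (z (t + s)) (B (z (t + s)))) U (𝓝 0) :=
    ((hz.tendsto_quadraticForm hS hB).comp
      (tendsto_atTop_add_const_right atTop s tendsto_id)).mono_left hU
  have h₃ : Tendsto (fun t => inner 𝕜 (z (t + s)) (B (z (t + s))) -
      inner 𝕜 (S s (z t)) (B (S s (z t)))) U (𝓝 0) := by
    have h₄ : Tendsto (fun t => 2 * ‖B‖ * ‖z₀‖ * ‖z (t + s) - S s (z t)‖) U (𝓝 0) := by
      simpa using ((hz.tendsto_sub_apply hS hB hs).mono_left hU).const_mul (2 * ‖B‖ * ‖z₀‖)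
    refine squeeze_zero_norm' ?_ h₄
    filter_upwards [hpos, hbd] with t ht hSz
    exact norm_quadraticForm_sub_le B (hz.norm_le_of_feedback hS (add_nonneg ht hs)) hSz
  have h₅ := h₂.sub h₃
  simp only [sub_sub_cancel, sub_zero] at h₅
  exact tendsto_nhds_unique h₁ h₅

end QuadraticFeedback

theorem mainTheorem8 {𝕜 H : Type*} [RCLike 𝕜] [NormedAddCommGroup H] [InnerProductSpace 𝕜 H]
    [NormedSpace ℝ H] [CompleteSpace H]
    (A : H →ₗ.[𝕜] H) (S : ℝ → H →L[𝕜] H)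
    (hS : IsContractionSemigroup S) (hA : IsGenerator A S)
    (B : H →L[𝕜] H) (hB : IsCompactOperator B)
    (hobs : ∀ y : H, (∀ t : ℝ, 0 ≤ t → inner 𝕜 (S t y) (B (S t y)) = 0) → y = 0) :
    IsWeaklyStabilizing S B (quadraticFeedback B) where
  exists_unique_solution := exists_unique_isMildSolution_feedback hS B
  -- The norm never exceeds its initial value, so `α = ε` works.
  lyapunov_stable ε hε := ⟨ε, hε, fun _ _ hz hlt _ ht =>
    (hz.norm_le_of_feedback hS ht).trans_lt hlt⟩
  tendsto_weakly z₀ z hz := by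
    refine tendsto_toWeakSpace_zero_of_inner fun x => ?_
    rw [tendsto_iff_ultrafilter]
    intro U hU
    obtain ⟨y, hy⟩ := exists_tendsto_inner_of_ultrafilter (𝕜 := 𝕜) (u := z) (R := ‖z₀‖) U <| by
      filter_upwards [hU (eventually_ge_atTop 0)] with t ht
      exact hz.norm_le_of_feedback hS ht
    have hy0 : y = 0 := hobs y fun s hs => hz.inner_eq_zero_of_weak_limit hS hB hU hy hs
    simpa [hy0] using hy x
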